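/- Let $(\Omega,\mathcal F,\mathbb P)$ be a nonatomic probability space (equivalently, one on which a random variable uniformly distributed on $[0,1]$ exists), let $X$ be an integrable random vector with values in $\mathbb R^N$ such that $\mathbb E(X)=0$, and let $Y$ be an integrable real random variable, both defined on $\Omega$. Then the correlation maximization problem with a mean-independence constraint and the shape-constrained Koenker–Bassett problem have the same, finite, value: $$\sup\Big\{\mathbb E(VY)\;:\;V\sim\mathcal U([0,1]),\ \mathbb E(X\mid V)=0\Big\} =\sup\Big\{\mathbb E\Big(\int_0^1 V_tY\,dt\Big)\;:\;V_t\in[0,1],\ t\mapsto V_t\text{ nonincreasing},\ \mathbb E(V_t)=1-t,\ \mathbb E(V_tX)=0\Big\}.$$ Here the first supremum is over all random variables $V$ on $\Omega$ satisfying the stated constraints, and the second is over all families $(V_t)_{t\in[0,1]}$ of random variables on $\Omega$ for which, almost surely, $V_t\in[0,1]$ for all $t\in[0,1]$ and $t\mapsto V_t$ is nonincreasing on $[0,1]$, and for which the two moment constraints hold for every $t\in[0,1]$. -/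

import Mathlib

open MeasureTheory Set

namespace KoenkerBassett

variable {Ω : Type*} [MeasurableSpace Ω]

/-- A real random variable `V` on `(Ω, P)` is uniformly distributed on `[0,1]`. -/
structure IsUniform01 (P : Measure Ω) (V : Ω → ℝ) : Prop where
  measurable : Measurable V
  law : P.map V = volume.restrict (Icc (0 : ℝ) 1)

/-- Nonatomicity of a probability space: it carries a uniformly distributed random variable.
(This is equivalent to: every event of positive probability contains an event of strictly smaller
positive probability. Mathlib's `NoAtoms`, which only speaks of singletons, is weaker.) -/
def IsNonatomic (P : Measure Ω) : Prop :=
  ∃ U : Ω → ℝ, IsUniform01 P U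

/-- Admissible variables of the correlation maximization problem: `V` is uniform on `[0,1]`
and `E(X | V) = 0`. -/
structure IsMeanIndepAdmissible {N : ℕ} (P : Measure Ω) (X : Ω → EuclideanSpace ℝ (Fin N))
    (V : Ω → ℝ) : Prop where
  uniform : IsUniform01 P V
  meanIndep : P[X | MeasurableSpace.comap V inferInstance] =ᵐ[P] 0

/-- The values `E(V Y)` of the correlation maximization problem with a mean-independence
constraint. -/
def correlationValues {N : ℕ} (P : Measure Ω) (X : Ω → EuclideanSpace ℝ (Fin N)) (Y : Ω → ℝ) :
    Set ℝ :=
  {r | ∃ V : Ω → ℝ, IsMeanIndepAdmissible P X V ∧ r = ∫ ω, V ω * Y ω ∂P}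

/-- Admissible families `(V_t)`, `t ∈ [0,1]`, of the shape-constrained Koenker–Bassett problem
(only the indices `t ∈ [0,1]` matter): random variables with values in `[0,1]`, almost surely
nonincreasing in `t`, with `E(V_t) = 1 - t` and `E(V_t X) = 0`. -/
structure IsMonotoneAdmissible {N : ℕ} (P : Measure Ω) (X : Ω → EuclideanSpace ℝ (Fin N))
    (V : ℝ → Ω → ℝ) : Prop where
  measurable : ∀ t ∈ Icc (0 : ℝ) 1, Measurable (V t)
  mem_Icc : ∀ᵐ ω ∂P, ∀ t ∈ Icc (0 : ℝ) 1, V t ω ∈ Icc (0 : ℝ) 1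
  antitone : ∀ᵐ ω ∂P, AntitoneOn (fun t => V t ω) (Icc (0 : ℝ) 1)
  mean : ∀ t ∈ Icc (0 : ℝ) 1, ∫ ω, V t ω ∂P = 1 - t
  orthogonal : ∀ t ∈ Icc (0 : ℝ) 1, ∫ ω, V t ω • X ω ∂P = 0

/-- The values `E(∫₀¹ V_t Y dt)` of the shape-constrained Koenker–Bassett problem. -/
def monotoneValues {N : ℕ} (P : Measure Ω) (X : Ω → EuclideanSpace ℝ (Fin N)) (Y : Ω → ℝ) :
    Set ℝ :=
  {r | ∃ V : ℝ → Ω → ℝ, IsMonotoneAdmissible P X V ∧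
    r = ∫ ω, (∫ t in (0 : ℝ)..1, V t ω * Y ω) ∂P}

end KoenkerBassett

/-!
The correlation problem is contained in the monotone problem: `V` is sent to the family of
indicators of `{t < V}`, which has the same value
(`KoenkerBassett.correlationValues_subset_monotoneValues`). The converse holds up to an arbitrarily
small error, and rests on Lyapunov's convexity theorem, `KoenkerBassett.lyapunov`: on a nonatomic
space a `[0,1]`-valued weight can be replaced by an event without changing finitely many integrals.

Given an admissible family `(V_t)`, sample it at the points `k / n`. Applying Lyapunov's theorem
repeatedly, to events nested in one another, turns the weights `V_{k/n}` into a decreasing sequence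
of events with the same probabilities and the same integrals of `X` and `Y`
(`KoenkerBassett.exists_nat_valued_setIntegral_eq`). Their successive differences form a partition
of `Ω` into `n` cells of probability `1 / n`, over each of which `X` has integral zero. The label of
the cell, divided by `n`, correlates with `Y` exactly as the Riemann sum of `V_t` does.

Such a partition can be halved over and over, again by Lyapunov's theorem, with `X` still
integrating to zero over every cell. The labels, divided by the number of cells, converge to a
uniform variable `V` with `E(X | V) = 0`, which differs by at most `1 / n` from the initial label
divided by `n` (`KoenkerBassett.IsBalancedLabel.exists_uniform`). Hence `E(VY)` is within
`2 E|Y| / n` of the value of the family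
(`KoenkerBassett.IsMonotoneAdmissible.exists_isMeanIndepAdmissible`).
-/

namespace KoenkerBassett

/-! ### Lyapunov's convexity theorem -/

section Lyapunov
variable {Ω : Type*} [MeasurableSpace Ω]

theorem integrable_mul_of_abs_le_one {μ : Measure Ω} {g h : Ω → ℝ} (hg : AEStronglyMeasurable g μ)
    (hg1 : ∀ᵐ ω ∂μ, |g ω| ≤ 1) (hh : Integrable h μ) : Integrable (fun ω => g ω * h ω) μ :=
  hh.bdd_mul hg (c := 1) (by simpa using hg1)

/-- Integration against a function bounded by `1`, as an element of the unit ball of the dual of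
`L¹`. -/
theorem exists_dual_integral_mul {μ : Measure Ω} {g : Ω → ℝ} (hg : Measurable g)
    (hg1 : ∀ ω, |g ω| ≤ 1) :
    ∃ φ : StrongDual ℝ (Lp ℝ 1 μ), ‖φ‖ ≤ 1 ∧
      ∀ h : Lp ℝ 1 μ, φ h = ∫ ω, g ω * h ω ∂μ := by
  have hint : ∀ h : Lp ℝ 1 μ, Integrable (fun ω => g ω * h ω) μ := fun h =>
    integrable_mul_of_abs_le_one hg.aestronglyMeasurable (.of_forall hg1) (L1.integrable_coeFn h)
  let L : Lp ℝ 1 μ →ₗ[ℝ] ℝ :=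
    { toFun := fun h => ∫ ω, g ω * h ω ∂μ
      map_add' := fun h k => by
        rw [← integral_add (hint h) (hint k)]
        refine integral_congr_ae ?_
        filter_upwards [Lp.coeFn_add h k] with ω hω
        rw [hω, Pi.add_apply, mul_add]
      map_smul' := fun c h => by
        rw [RingHom.id_apply, smul_eq_mul, ← integral_const_mul]
        refine integral_congr_ae ?_
        filter_upwards [Lp.coeFn_smul c h] with ω hω
        rw [hω, Pi.smul_apply, smul_eq_mul, mul_left_comm] }
  have hL : ∀ h, ‖L h‖ ≤ 1 * ‖h‖ := fun h => by
    rw [one_mul, L1.norm_eq_integral_norm]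
    refine norm_integral_le_of_norm_le (L1.integrable_coeFn h).norm (.of_forall fun ω => ?_)
    rw [norm_mul]
    exact mul_le_of_le_one_left (norm_nonneg _) (hg1 ω)
  exact ⟨L.mkContinuous 1 hL, L.mkContinuous_norm_le zero_le_one hL, fun h => rfl⟩

/-- A functional on `L¹` that lies between `0` and `μ` on indicator functions is integration
against a `[0,1]`-valued density. The density is obtained by restricting the functional to the
Hilbert space `L²`. -/
theorem exists_density_of_dual {μ : Measure Ω} [IsFiniteMeasure μ] (φ : StrongDual ℝ (Lp ℝ 1 μ))
    (hφ : ∀ (s : Set Ω) (hs : MeasurableSet s),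
      φ (indicatorConstLp 1 hs (measure_ne_top μ s) 1) ∈ Icc 0 (μ.real s)) :
    ∃ g : Ω → ℝ, Measurable g ∧ (∀ ω, g ω ∈ Icc (0 : ℝ) 1) ∧
      ∀ h : Lp ℝ 1 μ, φ h = ∫ ω, g ω * h ω ∂μ := by
  let B := ContinuousLinearMap.mul ℝ ℝ
  -- multiplication by the constant `1` of `L²` is the inclusion of `L²` in `L¹`
  let J : Lp ℝ 2 μ →L[ℝ] Lp ℝ 1 μ :=
    B.holderL μ 2 2 1 (indicatorConstLp 2 .univ (measure_ne_top μ univ) 1)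
  have hJ : ∀ h : Lp ℝ 2 μ, J h =ᵐ[μ] h := fun h => by
    filter_upwards [B.coeFn_holder (r := 1) (indicatorConstLp 2 .univ (measure_ne_top μ univ) 1) h,
      indicatorConstLp_coeFn (p := 2) (hs := .univ) (hμs := measure_ne_top μ univ) (c := (1 : ℝ))]
      with ω h1 h2
    simp only [J, ContinuousLinearMap.holderL_apply_apply]
    rw [h1, h2]
    simp [B]
  let G : Lp ℝ 2 μ := (InnerProductSpace.toDual ℝ (Lp ℝ 2 μ)).symm (φ.comp J)
  have hGint : Integrable G μ := (Lp.memLp G).integrable (by norm_num)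
  have hG : ∀ (s : Set Ω) (hs : MeasurableSet s),
      φ (indicatorConstLp 1 hs (measure_ne_top μ s) 1) = ∫ ω in s, G ω ∂μ := fun s hs => by
    have h1 : J (indicatorConstLp 2 hs (measure_ne_top μ s) 1)
        = indicatorConstLp 1 hs (measure_ne_top μ s) 1 := by
      apply Lp.ext
      exact (hJ _).trans (indicatorConstLp_coeFn.trans indicatorConstLp_coeFn.symm)
    have h2 : inner ℝ G (indicatorConstLp 2 hs (measure_ne_top μ s) (1 : ℝ)) =
        φ (J (indicatorConstLp 2 hs (measure_ne_top μ s) 1)) :=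
      InnerProductSpace.toDual_symm_apply
    rw [h1, real_inner_comm, L2.inner_indicatorConstLp_one] at h2
    exact h2.symm
  have h0 : 0 ≤ᵐ[μ] G := ae_nonneg_of_forall_setIntegral_nonneg hGint fun s hs _ => by
    rw [← hG s hs]; exact (hφ s hs).1
  have h1 : G ≤ᵐ[μ] fun _ => (1 : ℝ) :=
    ae_le_of_forall_setIntegral_le hGint (integrable_const 1) fun s hs _ => by
      rw [← hG s hs]; simpa using (hφ s hs).2
  let g : Ω → ℝ := fun ω => max 0 (min 1 (G ω))
  have hgm : Measurable g :=
    measurable_const.max (measurable_const.min (Lp.stronglyMeasurable G).measurable)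
  have hgI : ∀ ω, g ω ∈ Icc (0 : ℝ) 1 := fun ω =>
    ⟨le_max_left _ _, max_le zero_le_one (min_le_left _ _)⟩
  have hgG : g =ᵐ[μ] G := by
    filter_upwards [h0, h1] with ω h0 h1
    rw [Pi.zero_apply] at h0
    simp only [g, min_eq_right h1, max_eq_right h0]
  obtain ⟨ψ, -, hψ⟩ := exists_dual_integral_mul (μ := μ) hgm
    fun ω => abs_le.2 ⟨by linarith [(hgI ω).1], (hgI ω).2⟩
  refine ⟨g, hgm, hgI, fun h => ?_⟩
  rw [← hψ h]
  refine Lp.induction ENNReal.one_ne_top (motive := fun h => φ h = ψ h) ?_ ?_ ?_ h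
  · intro c s hs hμs
    have hc : (Lp.simpleFunc.indicatorConst 1 hs hμs.ne c : Lp ℝ 1 μ)
        = c • indicatorConstLp 1 hs (measure_ne_top μ s) (1 : ℝ) := by
      rw [Lp.simpleFunc.coe_indicatorConst]
      apply Lp.ext
      filter_upwards [indicatorConstLp_coeFn (p := 1) (hs := hs) (hμs := hμs.ne) (c := c),
        indicatorConstLp_coeFn (p := 1) (hs := hs) (hμs := hμs.ne) (c := (1 : ℝ)),
        Lp.coeFn_smul c (indicatorConstLp 1 hs (measure_ne_top μ s) (1 : ℝ))] with ω h1 h2 h3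
      rw [h1, h3, Pi.smul_apply, h2]
      by_cases hω : ω ∈ s <;> simp [hω]
    rw [hc, map_smul, map_smul, hG s hs, hψ, ← integral_indicator hs]
    congr 1
    refine integral_congr_ae ?_
    filter_upwards [indicatorConstLp_coeFn (p := 1) (hs := hs) (hμs := hμs.ne) (c := (1 : ℝ)),
      hgG] with ω h1 h2
    rw [h1, h2]
    by_cases hω : ω ∈ s <;> simp [hω]
  · intro f g hf hg _ h1 h2
    rw [map_add, map_add, h1, h2]
  · exact isClosed_eq φ.continuous ψ.continuous

/-- A polynomial has finitely many roots, and a variable with a diffuse law avoids them.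
Nonatomicity enters the convexity theorem only here. -/
theorem ae_eval_ne_zero {μ : Measure Ω} {U : Ω → ℝ}
    (hU0 : ∀ c, μ {ω | U ω = c} = 0) {p : Polynomial ℝ} (hp : p ≠ 0) :
    ∀ᵐ ω ∂μ, p.eval (U ω) ≠ 0 := by
  have h : ∀ᵐ ω ∂μ, ∀ c ∈ p.roots.toFinset, U ω ≠ c := by
    rw [Finset.eventually_all]
    exact fun c _ => by simpa [ae_iff] using hU0 c
  filter_upwards [h] with ω hω h0
  exact hω (U ω) (by simp [hp, h0]) rfl

/-- Finitely many linear conditions cannot be injective on the infinite-dimensional space of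
polynomials. -/
theorem exists_polynomial_integral_eq_zero {μ : Measure Ω} {ι : Type*} [Finite ι] {U : Ω → ℝ}
    (hU : Measurable U) (hUI : ∀ ω, U ω ∈ Icc (0 : ℝ) 1) {Z : ι → Ω → ℝ}
    (hZ : ∀ i, Integrable (Z i) μ) :
    ∃ p : Polynomial ℝ, p ≠ 0 ∧ (∀ x ∈ Icc (0 : ℝ) 1, |p.eval x| ≤ 1) ∧
      ∀ i, ∫ ω, p.eval (U ω) * Z i ω ∂μ = 0 := by
  have hbd : ∀ p : Polynomial ℝ, ∃ C : ℝ, ∀ x ∈ Icc (0 : ℝ) 1, ‖p.eval x‖ ≤ C := fun p =>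
    isCompact_Icc.exists_bound_of_continuousOn p.continuous.continuousOn
  have hint : ∀ (p : Polynomial ℝ) (i : ι), Integrable (fun ω => p.eval (U ω) * Z i ω) μ := by
    intro p i
    obtain ⟨C, hC⟩ := hbd p
    exact (hZ i).bdd_mul (p.continuous.measurable.comp hU).aestronglyMeasurable (c := C)
      (.of_forall fun ω => hC _ (hUI ω))
  let L : Polynomial ℝ →ₗ[ℝ] (ι → ℝ) :=
    { toFun := fun p i => ∫ ω, p.eval (U ω) * Z i ω ∂μ
      map_add' := fun p q => by
        ext i
        simp only [Polynomial.eval_add, add_mul, Pi.add_apply]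
        exact integral_add (hint p i) (hint q i)
      map_smul' := fun c p => by
        ext i
        simp only [Polynomial.eval_smul, smul_eq_mul, mul_assoc, Pi.smul_apply, RingHom.id_apply]
        exact integral_const_mul _ _ }
  have hL : ¬ Function.Injective L := fun h =>
    Polynomial.not_finite (R := ℝ) (Module.Finite.of_injective L h)
  obtain ⟨q, hq, hq0⟩ : ∃ q, L q = 0 ∧ q ≠ 0 := by
    by_contra! h
    exact hL ((injective_iff_map_eq_zero L).2 h)
  obtain ⟨C, hC⟩ := hbd q
  have hC0 : 0 < |C| + 1 := by positivity
  refine ⟨(|C| + 1)⁻¹ • q, smul_ne_zero (by positivity) hq0, fun x hx => ?_, fun i => ?_⟩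
  · rw [Polynomial.eval_smul, smul_eq_mul, abs_mul, abs_of_pos (by positivity), inv_mul_le_one₀ hC0]
    exact (hC x hx).trans (by linarith [le_abs_self C])
  · have := congrFun hq i
    change (∫ ω, q.eval (U ω) * Z i ω ∂μ) = 0 at this
    simp only [Polynomial.eval_smul, smul_eq_mul, mul_assoc]
    rw [integral_const_mul, this, mul_zero]

/-- **Lyapunov's convexity theorem**, in the form that a `[0,1]`-valued weight can be replaced by an
event without changing finitely many integrals; nonatomicity is witnessed by a variable `U` with a
diffuse law. This is Lindenstrauss's proof: the weights with the prescribed integrals form a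
weak-* compact set, and at an extreme point `g` there is no room for a perturbation, so that
`g (1 - g) = 0`. -/
theorem lyapunov {μ : Measure Ω} [IsFiniteMeasure μ] {ι : Type*} [Finite ι] {U : Ω → ℝ}
    (hU : Measurable U) (hUI : ∀ ω, U ω ∈ Icc (0 : ℝ) 1) (hU0 : ∀ c, μ {ω | U ω = c} = 0)
    {Z : ι → Ω → ℝ} (hZ : ∀ i, Integrable (Z i) μ)
    {f : Ω → ℝ} (hf : Measurable f) (hfI : ∀ ω, f ω ∈ Icc (0 : ℝ) 1) :
    ∃ A : Set Ω, MeasurableSet A ∧ ∀ i, ∫ ω in A, Z i ω ∂μ = ∫ ω, f ω * Z i ω ∂μ := by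
  have habs : ∀ {x : ℝ}, x ∈ Icc (0 : ℝ) 1 → |x| ≤ 1 := fun h =>
    abs_le.2 ⟨by linarith [h.1], h.2⟩
  -- `e s` is the class of the indicator function of `s` in `L¹`
  let e : ∀ s : Set Ω, MeasurableSet s → Lp ℝ 1 μ := fun s hs =>
    indicatorConstLp 1 hs (measure_ne_top μ s) 1
  have he : ∀ s hs, e s hs =ᵐ[μ] s.indicator fun _ => (1 : ℝ) := fun s hs =>
    indicatorConstLp_coeFn
  let K : Set (WeakDual ℝ (Lp ℝ 1 μ)) :=
    (WeakDual.toStrongDual ⁻¹' Metric.closedBall 0 1) ∩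
      ((⋂ s, ⋂ hs, {φ | φ (e s hs) ∈ Icc 0 (μ.real s)}) ∩
        ⋂ i, {φ | φ ((hZ i).toL1 (Z i)) = ∫ ω, f ω * Z i ω ∂μ})
  have hKc : IsCompact K := by
    refine (WeakDual.isCompact_closedBall 0 1).inter_right (IsClosed.inter ?_ ?_)
    · exact isClosed_iInter fun s => isClosed_iInter fun hs =>
        isClosed_Icc.preimage (WeakDual.eval_continuous _)
    · exact isClosed_iInter fun i => isClosed_eq (WeakDual.eval_continuous _) continuous_const
  have hK : ∀ g : Ω → ℝ, Measurable g → (∀ ω, g ω ∈ Icc (0 : ℝ) 1) →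
      (∀ i, ∫ ω, g ω * Z i ω ∂μ = ∫ ω, f ω * Z i ω ∂μ) →
      ∃ φ ∈ K, ∀ h : Lp ℝ 1 μ, φ h = ∫ ω, g ω * h ω ∂μ := by
    intro g hg hgI hgZ
    obtain ⟨φ, hφ1, hφ⟩ := exists_dual_integral_mul (μ := μ) hg fun ω => habs (hgI ω)
    refine ⟨StrongDual.toWeakDual φ, ⟨?_, ?_, ?_⟩, hφ⟩
    · simpa using hφ1
    · simp only [mem_iInter, mem_ofPred_eq]
      intro s hs
      have h1 : φ (e s hs) = ∫ ω in s, g ω ∂μ := by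
        rw [hφ, ← integral_indicator hs]
        refine integral_congr_ae ?_
        filter_upwards [he s hs] with ω hω
        rw [hω]
        by_cases h : ω ∈ s <;> simp [h]
      change φ (e s hs) ∈ _
      rw [h1]
      refine ⟨integral_nonneg fun ω => (hgI ω).1, ?_⟩
      calc ∫ ω in s, g ω ∂μ ≤ ∫ ω in s, (1 : ℝ) ∂μ :=
            integral_mono_of_nonneg (.of_forall fun ω => (hgI ω).1) (integrable_const _)
              (.of_forall fun ω => (hgI ω).2)
        _ = μ.real s := by simp
    · simp only [mem_iInter, mem_ofPred_eq]
      intro i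
      change φ _ = _
      rw [hφ, ← hgZ i]
      refine integral_congr_ae ?_
      filter_upwards [(hZ i).coeFn_toL1] with ω hω
      rw [hω]
  obtain ⟨φ, hφK, hφext⟩ : (K.extremePoints ℝ).Nonempty := by
    have : LocallyConvexSpace ℝ (WeakDual ℝ (Lp ℝ 1 μ)) :=
      inferInstanceAs (LocallyConvexSpace ℝ (WeakBilin (topDualPairing ℝ (Lp ℝ 1 μ))))
    obtain ⟨φ, hφ, -⟩ := hK f hf hfI fun _ => rfl
    exact hKc.extremePoints_nonempty ⟨φ, hφ⟩
  obtain ⟨g, hg, hgI, hφg⟩ := exists_density_of_dual (μ := μ) (WeakDual.toStrongDual φ)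
    fun s hs => mem_iInter.1 (mem_iInter.1 hφK.2.1 s) hs
  have hgZ : ∀ i, ∫ ω, g ω * Z i ω ∂μ = ∫ ω, f ω * Z i ω ∂μ := fun i => by
    rw [← (show φ ((hZ i).toL1 (Z i)) = _ from mem_iInter.1 hφK.2.2 i)]
    refine Eq.trans ?_ (hφg _).symm
    refine integral_congr_ae ?_
    filter_upwards [(hZ i).coeFn_toL1] with ω hω
    rw [hω]
  have hvI : ∀ ω, g ω * (1 - g ω) ∈ Icc (0 : ℝ) 1 := fun ω => by
    obtain ⟨h0, h1⟩ := hgI ω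
    exact ⟨by nlinarith, by nlinarith⟩
  have hvm : Measurable fun ω => g ω * (1 - g ω) := hg.mul (measurable_const.sub hg)
  -- `g (1 - g) ≤ min g (1 - g)`, so any multiple of it by a factor in `[-1, 1]` may be added to `g`;
  -- the factor `p(U)` is chosen so that the integrals against the `Z i` do not change
  obtain ⟨p, hp0, hp1, hpZ⟩ := exists_polynomial_integral_eq_zero hU hUI
    (Z := fun i ω => (g ω * (1 - g ω)) * Z i ω) fun i =>
      integrable_mul_of_abs_le_one hvm.aestronglyMeasurable
        (.of_forall fun ω => habs (hvI ω)) (hZ i)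
  -- the perturbation `d` of `g` stays within the constraints in both directions
  let d : Ω → ℝ := fun ω => p.eval (U ω) * (g ω * (1 - g ω))
  have hdm : Measurable d := (p.continuous.measurable.comp hU).mul hvm
  have hd : ∀ ω, |d ω| ≤ g ω * (1 - g ω) := fun ω => by
    simp only [d]
    rw [abs_mul, abs_of_nonneg (hvI ω).1]
    exact mul_le_of_le_one_left (hvI ω).1 (hp1 _ (hUI ω))
  have hd1 : ∀ ω, |d ω| ≤ 1 := fun ω => (hd ω).trans (hvI ω).2
  have hdint : Integrable d μ := Integrable.of_bound hdm.aestronglyMeasurable 1 (.of_forall hd1)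
  have hgint : ∀ {h : Ω → ℝ}, Integrable h μ → Integrable (fun ω => g ω * h ω) μ := fun hh =>
    integrable_mul_of_abs_le_one hg.aestronglyMeasurable (.of_forall fun ω => habs (hgI ω)) hh
  have hdint' : ∀ {h : Ω → ℝ}, Integrable h μ → Integrable (fun ω => d ω * h ω) μ := fun hh =>
    integrable_mul_of_abs_le_one hdm.aestronglyMeasurable (.of_forall hd1) hh
  have hdZ : ∀ i, ∫ ω, d ω * Z i ω ∂μ = 0 := fun i => by
    rw [← hpZ i]
    exact integral_congr_ae (.of_forall fun ω => by simp only [d]; ring)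
  obtain ⟨φ₁, hφ₁K, hφ₁⟩ := hK (fun ω => g ω + d ω) (hg.add hdm)
    (fun ω => by
      obtain ⟨h0, h1⟩ := hgI ω
      obtain ⟨h2, h3⟩ := abs_le.1 (hd ω)
      exact ⟨by nlinarith, by nlinarith⟩)
    (fun i => by
      simp only [add_mul]
      rw [integral_add (hgint (hZ i)) (hdint' (hZ i)), hdZ, add_zero, hgZ])
  obtain ⟨φ₂, hφ₂K, hφ₂⟩ := hK (fun ω => g ω - d ω) (hg.sub hdm)
    (fun ω => by
      obtain ⟨h0, h1⟩ := hgI ω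
      obtain ⟨h2, h3⟩ := abs_le.1 (hd ω)
      exact ⟨by nlinarith, by nlinarith⟩)
    (fun i => by
      simp only [sub_mul]
      rw [integral_sub (hgint (hZ i)) (hdint' (hZ i)), hdZ, sub_zero, hgZ])
  have hmid : φ ∈ openSegment ℝ φ₁ φ₂ := by
    refine ⟨1 / 2, 1 / 2, by norm_num, by norm_num, by norm_num, ?_⟩
    refine ContinuousLinearMap.ext fun h => ?_
    have hh := L1.integrable_coeFn h
    change (1 / 2 : ℝ) * φ₁ h + (1 / 2 : ℝ) * φ₂ h = φ h
    refine Eq.trans ?_ (hφg _).symm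
    rw [hφ₁, hφ₂]
    simp only [add_mul, sub_mul]
    rw [integral_add (hgint hh) (hdint' hh), integral_sub (hgint hh) (hdint' hh)]
    ring
  have hdd : ∫ ω, d ω * d ω ∂μ = 0 := by
    have h1 : φ₁ (hdint.toL1 d) = φ (hdint.toL1 d) := by
      rw [hφext hφ₁K hφ₂K hmid]
    have h2 : φ (hdint.toL1 d) = ∫ ω, g ω * (hdint.toL1 d) ω ∂μ := hφg _
    have hh := L1.integrable_coeFn (hdint.toL1 d)
    rw [h2, hφ₁] at h1
    simp only [add_mul] at h1
    rw [integral_add (hgint hh) (hdint' hh)] at h1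
    have h3 : ∫ ω, d ω * d ω ∂μ = ∫ ω, d ω * (hdint.toL1 d) ω ∂μ := by
      refine integral_congr_ae ?_
      filter_upwards [hdint.coeFn_toL1] with ω hω
      rw [hω]
    linarith
  have hd0 : ∀ᵐ ω ∂μ, d ω * d ω = 0 :=
    (integral_eq_zero_iff_of_nonneg (fun ω => mul_self_nonneg _) (hdint' hdint)).1 hdd
  have hg01 : ∀ᵐ ω ∂μ, g ω = 0 ∨ g ω = 1 := by
    filter_upwards [hd0, ae_eval_ne_zero hU0 hp0] with ω h1 h2
    have h3 : g ω * (1 - g ω) = 0 := by simpa [d, h2] using h1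
    rcases mul_eq_zero.1 h3 with h | h
    · exact .inl h
    · exact .inr (by linarith)
  refine ⟨g ⁻¹' {1}, hg (measurableSet_singleton _), fun i => ?_⟩
  rw [← hgZ i, ← integral_indicator (hg (measurableSet_singleton _))]
  refine integral_congr_ae ?_
  filter_upwards [hg01] with ω hω
  rcases hω with h | h <;> simp [indicator, h]

end Lyapunov

/-! ### Replacing a decreasing sequence of weights by a decreasing sequence of events -/

section Discretization
variable {Ω : Type*} [MeasurableSpace Ω]

/-- A decreasing sequence of weights `W 0 ≥ W 1 ≥ ⋯` can be replaced, up to index `n`, by the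
decreasing sequence of events `{k < N}` without changing finitely many integrals. The events are
constructed one inside the other: after `{0 < N}` has been chosen from the weight `W 0`, with the
integrals of `(W k / W 0) Z` prescribed as well, the ratios `W (k + 1) / W 0` restricted to it are
the weights for the next events. -/
theorem exists_nat_valued_setIntegral_eq {μ : Measure Ω} [IsFiniteMeasure μ] {ι : Type*} [Finite ι]
    {U : Ω → ℝ} (hU : Measurable U) (hUI : ∀ ω, U ω ∈ Icc (0 : ℝ) 1)
    (hU0 : ∀ c, μ {ω | U ω = c} = 0) {Z : ι → Ω → ℝ} (hZ : ∀ i, Integrable (Z i) μ) (n : ℕ) :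
    ∀ W : ℕ → Ω → ℝ, (∀ k, Measurable (W k)) → (∀ k ω, W k ω ∈ Icc (0 : ℝ) 1) →
      (∀ ω, Antitone fun k => W k ω) →
      ∃ N : Ω → ℕ, Measurable N ∧ (∀ ω, N ω ≤ n) ∧ (∀ ω, 0 < N ω → W 0 ω ≠ 0) ∧
        ∀ k < n, ∀ i, ∫ ω in {ω | k < N ω}, Z i ω ∂μ = ∫ ω, W k ω * Z i ω ∂μ := by
  induction n with
  | zero =>
    intro W _ _ _
    exact ⟨fun _ => 0, measurable_const, by simp, by simp, by simp⟩
  | succ n ih =>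
    intro W hW hWI hWa
    let R : ℕ → Ω → ℝ := fun k ω => W k ω / W 0 ω
    have hR : ∀ k, Measurable (R k) := fun k => (hW k).div (hW 0)
    have hRI : ∀ k ω, R k ω ∈ Icc (0 : ℝ) 1 := fun k ω =>
      ⟨div_nonneg (hWI k ω).1 (hWI 0 ω).1,
        div_le_one_of_le₀ (hWa ω (Nat.zero_le k)) (hWI 0 ω).1⟩
    have hR0 : ∀ k ω, W 0 ω = 0 → R k ω = 0 := fun k ω h => by simp [R, h]
    -- where `W 0` vanishes the quotient is `0` by convention, and so is `W k`
    have hRW : ∀ k ω, W 0 ω * R k ω = W k ω := fun k ω => by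
      by_cases h : W 0 ω = 0
      · have h1 := hWa ω (Nat.zero_le k)
        simp only [h] at h1
        rw [h, zero_mul, le_antisymm h1 (hWI k ω).1]
      · simp only [R]; field_simp
    obtain ⟨A, hA, hAZ⟩ := lyapunov (μ := μ) hU hUI hU0
      (Z := fun (q : ι × Fin (n + 1)) ω => R q.2 ω * Z q.1 ω)
      (fun q => integrable_mul_of_abs_le_one (hR q.2).aestronglyMeasurable
        (.of_forall fun ω => abs_le.2 ⟨by linarith [(hRI q.2 ω).1], (hRI q.2 ω).2⟩) (hZ q.1))
      (hW 0) (hWI 0)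
    let S : Set Ω := A ∩ {ω | W 0 ω ≠ 0}
    have hS0 : MeasurableSet {ω | W 0 ω ≠ 0} := (hW 0) (measurableSet_singleton 0).compl
    have hS : MeasurableSet S := hA.inter hS0
    have hSZ : ∀ k < n + 1, ∀ i, ∫ ω in S, R k ω * Z i ω ∂μ = ∫ ω, W k ω * Z i ω ∂μ := by
      intro k hk i
      have h1 := hAZ (i, ⟨k, hk⟩)
      simp only [← mul_assoc, hRW] at h1
      rw [← h1, ← integral_indicator hS, ← integral_indicator hA]
      refine integral_congr_ae (.of_forall fun ω => ?_)
      by_cases hωA : ω ∈ A <;> by_cases hω : W 0 ω = 0 <;>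
        simp [indicator, S, hωA, hω, hR0]
    obtain ⟨N, hN, hNn, hNS, hNZ⟩ := ih (fun k => S.indicator (R (k + 1)))
      (fun k => (hR _).indicator hS)
      (fun k ω => by
        by_cases h : ω ∈ S
        · simpa [h] using hRI (k + 1) ω
        · simp [h])
      (fun ω k l hkl => by
        by_cases h : ω ∈ S
        · simp only [h, indicator_of_mem, R]
          exact div_le_div_of_nonneg_right (hWa ω (by omega)) (hWI 0 ω).1
        · simp [h])
    have hNS' : ∀ ω, 0 < N ω → ω ∈ S := fun ω h => by
      by_contra h'
      exact hNS ω h (by simp [h'])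
    classical
    refine ⟨fun ω => if ω ∈ S then N ω + 1 else 0,
      Measurable.ite hS (hN.add_const 1) measurable_const, fun ω => ?_, fun ω h => ?_, ?_⟩
    · dsimp only
      split_ifs
      · exact Nat.succ_le_succ (hNn ω)
      · exact Nat.zero_le _
    · dsimp only at h
      split_ifs at h with hω
      · exact hω.2
      · exact absurd h (lt_irrefl 0)
    · intro k hk i
      rw [← hSZ k hk i]
      rcases k with _ | k
      · have : {ω | 0 < if ω ∈ S then N ω + 1 else 0} = S := by
          ext ω; by_cases h : ω ∈ S <;> simp [h]
        rw [this]
        refine setIntegral_congr_fun hS fun ω hω => ?_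
        have : W 0 ω ≠ 0 := hω.2
        simp [R, this]
      · have : {ω | k + 1 < if ω ∈ S then N ω + 1 else 0} = {ω | k < N ω} := by
          ext ω
          by_cases h : ω ∈ S
          · simp [h]
          · have : N ω = 0 := by
              by_contra h'
              exact h (hNS' ω (Nat.pos_of_ne_zero h'))
            simp [h, this]
        rw [this, hNZ k (by omega) i, ← integral_indicator hS]
        refine integral_congr_ae (.of_forall fun ω => ?_)
        by_cases h : ω ∈ S <;> simp [h]

end Discretization

/-! ### Balanced partitions and limits of discrete laws -/

section Refinement
variable {Ω : Type*} [MeasurableSpace Ω]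

/-- `N` labels the cells of a partition of `Ω` into `c` events of equal probability `1 / c`,
over each of which every `X i` has integral zero. -/
structure IsBalancedLabel {ι : Type*} (P : Measure Ω) (X : ι → Ω → ℝ) (c : ℕ) (N : Ω → ℕ) :
    Prop where
  measurable : Measurable N
  lt : ∀ ω, N ω < c
  real_eq : ∀ k < c, P.real {ω | N ω = k} = 1 / c
  integral_eq_zero : ∀ k < c, ∀ i, ∫ ω in {ω | N ω = k}, X i ω ∂P = 0

/-- Every cell of a balanced partition can be halved, simultaneously, into a balanced partition:
the half is the event that Lyapunov's theorem gives for the constant weight `1 / 2`. -/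
theorem IsBalancedLabel.exists_refine {P : Measure Ω} [IsFiniteMeasure P] {ι : Type*} [Finite ι]
    {U : Ω → ℝ} (hU : Measurable U) (hUI : ∀ ω, U ω ∈ Icc (0 : ℝ) 1)
    (hU0 : ∀ c, P {ω | U ω = c} = 0) {X : ι → Ω → ℝ} (hX : ∀ i, Integrable (X i) P)
    {c : ℕ} {N : Ω → ℕ} (hN : IsBalancedLabel P X c N) :
    ∃ N' : Ω → ℕ, IsBalancedLabel P X (c * 2) N' ∧
      ∀ ω, N' ω = 2 * N ω ∨ N' ω = 2 * N ω + 1 := by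
  have hNk : ∀ k, MeasurableSet {ω | N ω = k} := fun k => hN.measurable (measurableSet_singleton k)
  let Z : Option ι → Ω → ℝ := fun j => j.elim (fun _ => 1) X
  have hZ : ∀ j, Integrable (Z j) P := by
    rintro (_ | i)
    · exact integrable_const 1
    · exact hX i
  obtain ⟨D, hD, hDZ⟩ := lyapunov (μ := P) hU hUI hU0
    (Z := fun (q : Fin c × Option ι) => {ω | N ω = q.1}.indicator (Z q.2))
    (fun q => (hZ q.2).indicator (hNk _)) (f := fun _ => 1 / 2) measurable_const
    (fun _ => ⟨by norm_num, by norm_num⟩)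
  have hin : ∀ k < c, ∀ j, ∫ ω in {ω | N ω = k} ∩ D, Z j ω ∂P
      = 1 / 2 * ∫ ω in {ω | N ω = k}, Z j ω ∂P := by
    intro k hk j
    have := hDZ (⟨k, hk⟩, j)
    rw [integral_const_mul, integral_indicator (hNk _), integral_indicator (hNk _),
      Measure.restrict_restrict (hNk _)] at this
    exact this
  have hout : ∀ k < c, ∀ j, ∫ ω in {ω | N ω = k} \ D, Z j ω ∂P
      = 1 / 2 * ∫ ω in {ω | N ω = k}, Z j ω ∂P := by
    intro k hk j
    have h1 := integral_inter_add_sdiff (s := {ω | N ω = k}) hD (hZ j).integrableOn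
    rw [hin k hk j] at h1
    linarith
  classical
  let N' : Ω → ℕ := fun ω => 2 * N ω + if ω ∈ D then 1 else 0
  have h1 : ∀ k, {ω | N' ω = 2 * k + 1} = {ω | N ω = k} ∩ D := fun k => by
    ext ω; by_cases h : ω ∈ D <;> simp [N', h]; omega
  have h0 : ∀ k, {ω | N' ω = 2 * k} = {ω | N ω = k} \ D := fun k => by
    ext ω; by_cases h : ω ∈ D <;> simp [N', h]; omega
  have key : ∀ l < c * 2, ∃ k < c, ∀ j, ∫ ω in {ω | N' ω = l}, Z j ω ∂P
      = 1 / 2 * ∫ ω in {ω | N ω = k}, Z j ω ∂P := by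
    intro l hl
    refine ⟨l / 2, by omega, fun j => ?_⟩
    rcases Nat.even_or_odd' l with ⟨k, rfl | rfl⟩
    · rw [h0, hout k (by omega), Nat.mul_div_cancel_left k two_pos]
    · rw [h1, hin k (by omega), show (2 * k + 1) / 2 = k by omega]
  refine ⟨N', ⟨?_, fun ω => ?_, fun l hl => ?_, fun l hl i => ?_⟩, fun ω => ?_⟩
  · exact (hN.measurable.const_mul 2).add (Measurable.ite hD measurable_const measurable_const)
  · have := hN.lt ω
    simp only [N']
    split_ifs <;> omega
  · obtain ⟨k, hk, h⟩ := key l hl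
    have h := h none
    simp only [Z, Option.elim, setIntegral_const, smul_eq_mul, mul_one] at h
    rw [h, hN.real_eq k hk]
    push_cast
    rw [one_div_mul_one_div, mul_comm]
  · obtain ⟨k, hk, h⟩ := key l hl
    have h := h (some i)
    simp only [Z, Option.elim] at h
    rw [h, hN.integral_eq_zero k hk, mul_zero]
  · simp only [N']
    split_ifs <;> simp

theorem tendsto_integral_boundedContinuousFunction_map {α : Type*} [MeasurableSpace α]
    {μ : Measure α} [IsFiniteMeasure μ] {A : ℕ → α → ℝ} {V : α → ℝ} (hA : ∀ m, Measurable (A m))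
    (hAV : ∀ᵐ x ∂μ, Filter.Tendsto (fun m => A m x) Filter.atTop (nhds (V x)))
    (φ : BoundedContinuousFunction ℝ ℝ) :
    Filter.Tendsto (fun m => ∫ x, φ x ∂(μ.map (A m))) Filter.atTop
      (nhds (∫ x, φ (V x) ∂μ)) := by
  have hφ := φ.continuous.stronglyMeasurable
  simp_rw [fun m => integral_map (hA m).aemeasurable (μ := μ) hφ.aestronglyMeasurable]
  refine tendsto_integral_of_dominated_convergence (fun _ => ‖φ‖)
    (fun m => (hφ.comp_measurable (hA m)).aestronglyMeasurable) (integrable_const _)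
    (fun m => .of_forall fun x => φ.norm_coe_le_norm _) ?_
  filter_upwards [hAV] with x hx
  exact (φ.continuous.tendsto _).comp hx

/-- Almost sure limits of two sequences with equal laws have equal laws. The two measures need
not be probabilities, nor live on the same space. -/
theorem map_eq_map_of_tendsto {α β : Type*} [MeasurableSpace α] [MeasurableSpace β]
    {μ : Measure α} {ν : Measure β} [IsFiniteMeasure μ] [IsFiniteMeasure ν]
    {A : ℕ → α → ℝ} {B : ℕ → β → ℝ} {V : α → ℝ} {W : β → ℝ}
    (hA : ∀ m, Measurable (A m)) (hB : ∀ m, Measurable (B m)) (hV : Measurable V)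
    (hW : Measurable W) (hAB : ∀ m, μ.map (A m) = ν.map (B m))
    (hAV : ∀ᵐ x ∂μ, Filter.Tendsto (fun m => A m x) Filter.atTop (nhds (V x)))
    (hBW : ∀ᵐ x ∂ν, Filter.Tendsto (fun m => B m x) Filter.atTop (nhds (W x))) :
    μ.map V = ν.map W := by
  refine ext_of_forall_integral_eq_of_IsFiniteMeasure fun φ => ?_
  have hφ := φ.continuous.stronglyMeasurable
  rw [integral_map hV.aemeasurable hφ.aestronglyMeasurable,
    integral_map hW.aemeasurable hφ.aestronglyMeasurable]
  have h1 := tendsto_integral_boundedContinuousFunction_map hA hAV φ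
  simp_rw [hAB] at h1
  exact tendsto_nhds_unique h1 (tendsto_integral_boundedContinuousFunction_map hB hBW φ)

end Refinement

/-! ### A mean-independent uniform variable from a balanced partition -/

section Limit
variable {Ω : Type*} [MeasurableSpace Ω]

theorem map_div_eq_map_div {α β : Type*} [MeasurableSpace α] [MeasurableSpace β]
    {μ : Measure α} {ν : Measure β} {N : α → ℕ} {M : β → ℕ} (hN : Measurable N)
    (hM : Measurable M) (h : ∀ k, μ {x | N x = k} = ν {x | M x = k}) (c : ℝ) :
    μ.map (fun x => (N x : ℝ) / c) = ν.map (fun x => (M x : ℝ) / c) := by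
  have hNM : μ.map N = ν.map M := by
    refine Measure.ext_of_singleton fun k => ?_
    rw [Measure.map_apply hN (measurableSet_singleton k),
      Measure.map_apply hM (measurableSet_singleton k)]
    exact h k
  have hg : Measurable fun k : ℕ => (k : ℝ) / c := measurable_of_countable _
  have h1 := Measure.map_map hg hN (μ := μ)
  have h2 := Measure.map_map hg hM (μ := ν)
  rw [hNM] at h1
  exact h1.symm.trans h2

/-- Under the uniform law on `[0,1]`, the label `⌊c x⌋` takes each value below `c` with
probability `1 / c`. -/
theorem volume_floor_mul_eq {c : ℕ} (hc : 0 < c) {k : ℕ} (hk : k < c) :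
    (volume.restrict (Icc (0 : ℝ) 1)) {x | ⌊(c : ℝ) * x⌋₊ = k} = ENNReal.ofReal (1 / c) := by
  have hm : MeasurableSet {x : ℝ | ⌊(c : ℝ) * x⌋₊ = k} :=
    (Nat.measurable_floor.comp (measurable_const.mul measurable_id)) (measurableSet_singleton k)
  have hc' : (0 : ℝ) < c := by exact_mod_cast hc
  have hk' : (k : ℝ) + 1 ≤ c := by exact_mod_cast hk
  rw [Measure.restrict_apply hm]
  have hle : Ico ((k : ℝ) / c) ((k + 1) / c) ⊆ {x : ℝ | ⌊(c : ℝ) * x⌋₊ = k} ∩ Icc 0 1 := by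
    rintro x ⟨h1, h2⟩
    rw [div_le_iff₀ hc'] at h1
    rw [lt_div_iff₀ hc'] at h2
    have hx : 0 ≤ x := by
      by_contra! h
      nlinarith [(Nat.cast_nonneg k : (0 : ℝ) ≤ k)]
    refine ⟨(Nat.floor_eq_iff (by positivity)).2 ⟨by linarith, by linarith⟩, hx, ?_⟩
    by_contra! h
    nlinarith
  have hge : {x : ℝ | ⌊(c : ℝ) * x⌋₊ = k} ∩ Icc 0 1 ⊆ Ico ((k : ℝ) / c) ((k + 1) / c) := by
    rintro x ⟨h1, h2, h3⟩
    obtain ⟨h4, h5⟩ := (Nat.floor_eq_iff (by positivity)).1 h1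
    constructor
    · rw [div_le_iff₀ hc']; linarith
    · rw [lt_div_iff₀ hc']; linarith
  rw [hge.antisymm hle, Real.volume_Ico]
  congr 1
  ring

theorem volume_floor_mul_eq_zero {c : ℕ} (hc : 0 < c) {k : ℕ} (hk : c ≤ k) :
    (volume.restrict (Icc (0 : ℝ) 1)) {x | ⌊(c : ℝ) * x⌋₊ = k} = 0 := by
  have hm : MeasurableSet {x : ℝ | ⌊(c : ℝ) * x⌋₊ = k} :=
    (Nat.measurable_floor.comp (measurable_const.mul measurable_id)) (measurableSet_singleton k)
  have hc' : (0 : ℝ) < c := by exact_mod_cast hc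
  have hk' : (c : ℝ) ≤ k := by exact_mod_cast hk
  rw [Measure.restrict_apply hm]
  refine measure_mono_null ?_ (measure_singleton (1 : ℝ))
  rintro x ⟨h1, h2, h3⟩
  obtain ⟨h4, -⟩ := (Nat.floor_eq_iff (by positivity)).1 h1
  refine le_antisymm h3 ?_
  by_contra! h
  nlinarith

theorem IsBalancedLabel.measure_eq_volume {P : Measure Ω} [IsFiniteMeasure P] {ι : Type*}
    {X : ι → Ω → ℝ} {c : ℕ} (hc : 0 < c) {N : Ω → ℕ} (hN : IsBalancedLabel P X c N) (k : ℕ) :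
    P {ω | N ω = k} = (volume.restrict (Icc (0 : ℝ) 1)) {x | ⌊(c : ℝ) * x⌋₊ = k} := by
  by_cases hk : k < c
  · rw [volume_floor_mul_eq hc hk, ← hN.real_eq k hk, ofReal_measureReal]
  · rw [volume_floor_mul_eq_zero hc (not_lt.1 hk)]
    convert measure_empty (μ := P)
    ext ω
    simpa using fun h : N ω = k => hk (h ▸ hN.lt ω)

/-- The positive and negative parts of `f` have the same integral over `s` exactly when `f`
integrates to zero over `s`. -/
theorem withDensity_ofReal_eq_iff {μ : Measure Ω} {f : Ω → ℝ} (hf : Integrable f μ) {s : Set Ω}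
    (hs : MeasurableSet s) :
    μ.withDensity (fun ω => ENNReal.ofReal (f ω)) s
        = μ.withDensity (fun ω => ENNReal.ofReal (-f ω)) s ↔ ∫ ω in s, f ω ∂μ = 0 := by
  have h1 : ∫⁻ ω in s, ENNReal.ofReal (f ω) ∂μ ≠ ⊤ := by
    refine ne_top_of_le_ne_top hf.integrableOn.2.ne (lintegral_mono fun ω => ?_)
    exact Real.ofReal_le_enorm _
  have h2 : ∫⁻ ω in s, ENNReal.ofReal (-f ω) ∂μ ≠ ⊤ := by
    refine ne_top_of_le_ne_top hf.neg.integrableOn.2.ne (lintegral_mono fun ω => ?_)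
    exact Real.ofReal_le_enorm _
  rw [withDensity_apply _ hs, withDensity_apply _ hs,
    integral_eq_lintegral_pos_part_sub_lintegral_neg_part hf.integrableOn, sub_eq_zero,
    ENNReal.toReal_eq_toReal_iff' h1 h2]

/-- If `f` integrates to zero over the level sets of the discrete variables `N m`, then it does so
over the events of their rescaled limit `V`: the measures with densities `f⁺` and `f⁻` give `N m`
the same law, hence also `V`. -/
theorem setIntegral_preimage_eq_zero_of_tendsto {μ : Measure Ω} {f : Ω → ℝ} (hf : Integrable f μ)
    {N : ℕ → Ω → ℕ} (hN : ∀ m, Measurable (N m)) (c : ℕ → ℝ) {V : Ω → ℝ} (hV : Measurable V)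
    (hNf : ∀ m k, ∫ ω in {ω | N m ω = k}, f ω ∂μ = 0)
    (hNV : ∀ ω, Filter.Tendsto (fun m => (N m ω : ℝ) / c m) Filter.atTop (nhds (V ω)))
    {B : Set ℝ} (hB : MeasurableSet B) : ∫ ω in V ⁻¹' B, f ω ∂μ = 0 := by
  have := isFiniteMeasure_withDensity_ofReal hf.2
  have := isFiniteMeasure_withDensity_ofReal hf.neg.2
  rw [← withDensity_ofReal_eq_iff hf (hV hB), ← Measure.map_apply hV hB]
  have hm : ∀ m, Measurable fun ω => (N m ω : ℝ) / c m := fun m =>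
    (measurable_of_countable fun k : ℕ => (k : ℝ) / c m).comp (hN m)
  rw [map_eq_map_of_tendsto (μ := μ.withDensity fun ω => ENNReal.ofReal (f ω))
    (ν := μ.withDensity fun ω => ENNReal.ofReal (-f ω)) hm hm hV hV (fun m => ?_)
    (.of_forall hNV) (.of_forall hNV), Measure.map_apply hV hB]
  refine map_div_eq_map_div (hN m) (hN m) (fun k => ?_) _
  exact (withDensity_ofReal_eq_iff hf (hN m (measurableSet_singleton k))).2 (hNf m k)

/-- Refining a balanced partition by repeated halving, the rescaled labels converge to a uniform
variable `V` which is within `1 / c` of the initial label and with respect to which every `X i` has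
zero conditional mean. -/
theorem IsBalancedLabel.exists_uniform {P : Measure Ω} [IsFiniteMeasure P] {ι : Type*} [Finite ι]
    {U : Ω → ℝ} (hU : Measurable U) (hUI : ∀ ω, U ω ∈ Icc (0 : ℝ) 1)
    (hU0 : ∀ c, P {ω | U ω = c} = 0) {X : ι → Ω → ℝ} (hX : ∀ i, Integrable (X i) P)
    {c : ℕ} (hc : 0 < c) {N : Ω → ℕ} (hN : IsBalancedLabel P X c N) :
    ∃ V : Ω → ℝ, IsUniform01 P V ∧
      (∀ B, MeasurableSet B → ∀ i, ∫ ω in V ⁻¹' B, X i ω ∂P = 0) ∧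
      ∀ ω, V ω - N ω / c ∈ Icc (0 : ℝ) (1 / c) := by
  choose! F hF hFs using fun (c : ℕ) (N : Ω → ℕ) (h : IsBalancedLabel P X c N) =>
    h.exists_refine hU hUI hU0 hX
  obtain ⟨M, hM0, hM, hMs⟩ : ∃ M : ℕ → Ω → ℕ, M 0 = N ∧
      (∀ m, IsBalancedLabel P X (c * 2 ^ m) (M m)) ∧
      ∀ m ω, M (m + 1) ω = 2 * M m ω ∨ M (m + 1) ω = 2 * M m ω + 1 := by
    let M : ℕ → Ω → ℕ := fun m => Nat.rec N (fun m K => F (c * 2 ^ m) K) m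
    have hM : ∀ m, IsBalancedLabel P X (c * 2 ^ m) (M m) := fun m => by
      induction m with
      | zero => simpa [M] using hN
      | succ m ih =>
        rw [pow_succ, ← mul_assoc]
        exact hF _ _ ih
    exact ⟨M, rfl, hM, fun m ω => hFs _ _ (hM m) ω⟩
  have hc' : (0 : ℝ) < c := by exact_mod_cast hc
  have hcm : ∀ m, (0 : ℝ) < c * 2 ^ m := fun m => by positivity
  let A : ℕ → Ω → ℝ := fun m ω => ((M m ω : ℕ) : ℝ) / ((c : ℝ) * 2 ^ m)
  have hAm : ∀ m, Measurable (A m) := fun m =>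
    (measurable_of_countable fun k : ℕ => (k : ℝ) / ((c : ℝ) * 2 ^ m)).comp (hM m).measurable
  have hA1 : ∀ ω, Monotone fun m => A m ω := fun ω => monotone_nat_of_le_succ fun m => by
    simp only [A]
    rw [div_le_div_iff₀ (hcm _) (hcm _), pow_succ]
    rcases hMs m ω with h | h <;> rw [h] <;> push_cast <;> nlinarith [hcm m]
  have hA2 : ∀ ω, Antitone fun m => A m ω + 1 / (c * 2 ^ m) := fun ω =>
    antitone_nat_of_succ_le fun m => by
      simp only [A]
      rw [← add_div, ← add_div, div_le_div_iff₀ (hcm _) (hcm _), pow_succ]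
      rcases hMs m ω with h | h <;> rw [h] <;> push_cast <;> nlinarith [hcm m]
  have hAle : ∀ ω m l, A m ω ≤ A l ω + 1 / (c * 2 ^ l) := fun ω m l => by
    have h1 := hA1 ω (le_max_left m l)
    have h2 := hA2 ω (le_max_right m l)
    have h3 : (0 : ℝ) ≤ 1 / (c * 2 ^ (max m l)) := by positivity
    simp only at h1 h2
    linarith
  have hbdd : ∀ ω, BddAbove (range fun m => A m ω) := fun ω =>
    ⟨A 0 ω + 1 / (c * 2 ^ 0), by rintro _ ⟨m, rfl⟩; exact hAle ω m 0⟩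
  let V : Ω → ℝ := fun ω => ⨆ m, A m ω
  have hAV : ∀ ω, Filter.Tendsto (fun m => A m ω) Filter.atTop (nhds (V ω)) := fun ω =>
    tendsto_atTop_ciSup (hA1 ω) (hbdd ω)
  have hV : Measurable V := measurable_of_tendsto_metrizable hAm (tendsto_pi_nhds.2 hAV)
  refine ⟨V, ⟨hV, ?_⟩, fun B hB i => ?_, fun ω => ?_⟩
  -- the label of the `m`-th partition has the law of `⌊c 2ᵐ x⌋` under the uniform law, and
  -- `⌊c 2ᵐ x⌋ / (c 2ᵐ)` tends to `x`
  · rw [← Measure.map_id (μ := volume.restrict (Icc (0 : ℝ) 1))]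
    refine map_eq_map_of_tendsto hAm
      (B := fun m x => (⌊((c * 2 ^ m : ℕ) : ℝ) * x⌋₊ : ℝ) / (c * 2 ^ m)) (fun m => ?_) hV
      measurable_id (fun m => ?_) (.of_forall hAV) ?_
    · exact (measurable_of_countable fun k : ℕ => (k : ℝ) / (c * 2 ^ m)).comp
        (Nat.measurable_floor.comp (measurable_const.mul measurable_id))
    · exact map_div_eq_map_div (hM m).measurable
        (Nat.measurable_floor.comp (measurable_const.mul measurable_id))
        ((hM m).measure_eq_volume (by positivity)) _
    · filter_upwards [ae_restrict_mem measurableSet_Icc] with x hx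
      have h1 : Filter.Tendsto (fun m : ℕ => (c : ℝ) * 2 ^ m) Filter.atTop Filter.atTop :=
        (tendsto_pow_atTop_atTop_of_one_lt one_lt_two).const_mul_atTop hc'
      have h2 := (tendsto_nat_floor_mul_div_atTop hx.1).comp h1
      refine h2.congr fun m => ?_
      simp [mul_comm x]
  · refine setIntegral_preimage_eq_zero_of_tendsto (hX i) (fun m => (hM m).measurable)
      (fun m => c * 2 ^ m) hV (fun m k => ?_) hAV hB
    by_cases hk : k < c * 2 ^ m
    · exact (hM m).integral_eq_zero k hk i
    · have : {ω | M m ω = k} = ∅ := by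
        ext ω
        simpa using fun h : M m ω = k => hk (h ▸ (hM m).lt ω)
      simp [this]
  · have h0 : A 0 ω = N ω / c := by simp [A, hM0]
    have h1 : A 0 ω ≤ V ω := le_ciSup (hbdd ω) 0
    have h2 : V ω ≤ A 0 ω + 1 / (c * 2 ^ 0) := ciSup_le fun m => hAle ω m 0
    rw [h0] at h1 h2
    simp only [pow_zero, mul_one] at h2
    exact ⟨by linarith, by linarith⟩

end Limit

/-! ### Riemann sums of monotone functions -/

section RiemannSum

theorem abs_integral_sub_riemannSum_le {v : ℝ → ℝ} (hv : AntitoneOn v (Icc 0 1))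
    (hvI : ∀ t ∈ Icc (0 : ℝ) 1, v t ∈ Icc (0 : ℝ) 1) (M : ℕ) :
    |(∫ t in (0 : ℝ)..1, v t) -
      (1 / (M + 1 : ℝ)) * ∑ k ∈ Finset.range M, v ((k + 1) / (M + 1))| ≤ 1 / (M + 1) := by
  have hn : (0 : ℝ) < M + 1 := by positivity
  have hmem : ∀ {x : ℝ}, x ∈ Icc (0 : ℝ) (0 + (M + 1 : ℕ)) → x / (M + 1) ∈ Icc (0 : ℝ) 1 := by
    rintro x ⟨h0, h1⟩
    push_cast at h1
    exact ⟨by positivity, by rw [div_le_one hn]; linarith⟩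
  have hanti : AntitoneOn (fun x : ℝ => v (x / (M + 1))) (Icc 0 (0 + (M + 1 : ℕ))) :=
    fun x hx y hy hxy => hv (hmem hx) (hmem hy) (by gcongr)
  have h1 := hanti.integral_le_sum
  have h2 := hanti.sum_le_integral
  have hI : ∫ x in (0 : ℝ)..(0 + (M + 1 : ℕ)), v (x / (M + 1))
      = (M + 1) * ∫ t in (0 : ℝ)..1, v t := by
    rw [intervalIntegral.integral_comp_div (fun t => v t) hn.ne']
    push_cast
    rw [zero_div, zero_add, div_self hn.ne', smul_eq_mul]
  rw [hI] at h1 h2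
  rw [Finset.sum_range_succ'] at h1
  rw [Finset.sum_range_succ] at h2
  simp only [zero_add] at h1 h2
  push_cast at h1 h2
  rw [zero_div] at h1
  rw [div_self hn.ne'] at h2
  have h3 := (hvI 0 (by simp)).2
  have h4 := (hvI 1 (by simp)).1
  set I := ∫ t in (0 : ℝ)..1, v t
  set S := ∑ k ∈ Finset.range M, v ((k + 1) / (M + 1))
  have h5 : I - (1 / (M + 1 : ℝ)) * S = ((M + 1) * I - S) / (M + 1) := by field_simp
  rw [h5, abs_div, abs_of_pos hn]
  gcongr
  rw [abs_le]
  constructor <;> linarith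

end RiemannSum

/-! ### Elementary facts on the two problems -/

section Problems
variable {Ω : Type*} [MeasurableSpace Ω] {P : Measure Ω}

theorem IsUniform01.ae_mem_Icc {V : Ω → ℝ} (hV : IsUniform01 P V) :
    ∀ᵐ ω ∂P, V ω ∈ Icc (0 : ℝ) 1 := by
  refine ae_of_ae_map hV.measurable.aemeasurable ?_
  rw [hV.law]
  exact ae_restrict_mem measurableSet_Icc

theorem IsUniform01.measure_Ioi {V : Ω → ℝ} (hV : IsUniform01 P V) {t : ℝ}
    (ht : t ∈ Icc (0 : ℝ) 1) : P.real {ω | t < V ω} = 1 - t := by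
  have h : P {ω | t < V ω} = ENNReal.ofReal (1 - t) := by
    rw [show {ω | t < V ω} = V ⁻¹' Ioi t from rfl, ← Measure.map_apply hV.measurable
      measurableSet_Ioi, hV.law, Measure.restrict_apply measurableSet_Ioi, ← Real.volume_Ioc]
    congr 1
    ext x
    exact ⟨fun h => ⟨h.1, h.2.2⟩, fun h => ⟨h.1, ht.1.trans h.1.le, h.2⟩⟩
  rw [measureReal_def, h, ENNReal.toReal_ofReal (by linarith [ht.2])]

theorem IsNonatomic.exists_bounded (hP : IsNonatomic P) :
    ∃ U : Ω → ℝ, Measurable U ∧ (∀ ω, U ω ∈ Icc (0 : ℝ) 1) ∧ ∀ c, P {ω | U ω = c} = 0 := by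
  obtain ⟨U, hU⟩ := hP
  refine ⟨fun ω => max 0 (min 1 (U ω)),
    measurable_const.max (measurable_const.min hU.measurable),
    fun ω => ⟨le_max_left _ _, max_le zero_le_one (min_le_left _ _)⟩, fun c => ?_⟩
  have h : P (U ⁻¹' {c}) = 0 := by
    rw [← Measure.map_apply hU.measurable (measurableSet_singleton c), hU.law]
    exact measure_singleton c
  rw [← h]
  refine measure_congr ?_
  filter_upwards [hU.ae_mem_Icc] with ω hω
  refine propext ?_
  change max 0 (min 1 (U ω)) = c ↔ U ω = c
  rw [min_eq_right hω.2, max_eq_right hω.1]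

theorem integrable_coord {N : ℕ} {X : Ω → EuclideanSpace ℝ (Fin N)}
    (hX : Integrable X P) (i : Fin N) : Integrable (fun ω => X ω i) P :=
  (EuclideanSpace.proj i : EuclideanSpace ℝ (Fin N) →L[ℝ] ℝ).integrable_comp hX

theorem integral_coord {N : ℕ} {X : Ω → EuclideanSpace ℝ (Fin N)}
    (hX : Integrable X P) (i : Fin N) : ∫ ω, X ω i ∂P = (∫ ω, X ω ∂P) i :=
  (EuclideanSpace.proj i : EuclideanSpace ℝ (Fin N) →L[ℝ] ℝ).integral_comp_comm hX

theorem setIntegral_eq_zero_of_forall_coord {N : ℕ} {X : Ω → EuclideanSpace ℝ (Fin N)}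
    (hX : Integrable X P) {s : Set Ω} (h : ∀ i, ∫ ω in s, X ω i ∂P = 0) :
    ∫ ω in s, X ω ∂P = 0 := by
  ext i
  rw [← integral_coord hX.integrableOn, h i]
  rfl

theorem IsMeanIndepAdmissible.of_setIntegral [IsFiniteMeasure P] {N : ℕ}
    {X : Ω → EuclideanSpace ℝ (Fin N)} (hX : Integrable X P) {V : Ω → ℝ} (hV : IsUniform01 P V)
    (h : ∀ B, MeasurableSet B → ∀ i, ∫ ω in V ⁻¹' B, X ω i ∂P = 0) :
    IsMeanIndepAdmissible P X V := by
  refine ⟨hV, ?_⟩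
  have hm := hV.measurable.comap_le
  symm
  refine ae_eq_condExp_of_forall_setIntegral_eq hm hX
    (fun _ _ _ => (integrable_zero _ _ _).integrableOn) ?_ aestronglyMeasurable_zero
  rintro _ ⟨B, hB, rfl⟩ -
  rw [setIntegral_eq_zero_of_forall_coord hX (h B hB)]
  simp

theorem integral_indicator_lt_eq {v y : ℝ} (hv : v ∈ Icc (0 : ℝ) 1) :
    ∫ t in (0 : ℝ)..1, (if t < v then (1 : ℝ) else 0) * y = v * y := by
  rw [intervalIntegral.integral_mul_const]
  congr 1
  rw [intervalIntegral.integral_of_le zero_le_one]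
  have : (fun t : ℝ => if t < v then (1 : ℝ) else 0) = (Iio v).indicator fun _ => 1 := by
    ext t; simp [indicator]
  rw [this, setIntegral_indicator measurableSet_Iio, setIntegral_const, smul_eq_mul, mul_one,
    measureReal_def]
  have h : volume (Ioc (0 : ℝ) 1 ∩ Iio v) = volume (Ioc (0 : ℝ) v) := by
    apply le_antisymm
    · exact measure_mono fun t ht => ⟨ht.1.1, ht.2.le⟩
    · rw [Real.volume_Ioc, ← Real.volume_Ioo]
      exact measure_mono fun t ht => ⟨⟨ht.1, ht.2.le.trans hv.2⟩, ht.2⟩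
  rw [h, Real.volume_Ioc, sub_zero, ENNReal.toReal_ofReal hv.1]

/-- An admissible `V` of the correlation problem yields the admissible family of indicators of
`{t < V}`. -/
theorem IsMeanIndepAdmissible.isMonotoneAdmissible [IsFiniteMeasure P] {N : ℕ}
    {X : Ω → EuclideanSpace ℝ (Fin N)} (hX : Integrable X P) {V : Ω → ℝ}
    (hV : IsMeanIndepAdmissible P X V) :
    IsMonotoneAdmissible P X fun t ω => if t < V ω then (1 : ℝ) else 0 := by
  have hm := hV.uniform.measurable
  have hset : ∀ t, MeasurableSet {ω | t < V ω} := fun t => hm measurableSet_Ioi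
  refine ⟨fun t _ => Measurable.ite (hset t) measurable_const measurable_const,
    .of_forall fun ω t _ => ?_, .of_forall fun ω s _ t _ hst => ?_, fun t ht => ?_, fun t ht => ?_⟩
  · split_ifs <;> simp
  · dsimp only
    split_ifs with h1 h2
    · rfl
    · exact absurd (hst.trans_lt h1) h2
    · exact zero_le_one
    · rfl
  · rw [← hV.uniform.measure_Ioi ht, ← integral_indicator_one (hset t)]
    rfl
  · have h1 : (fun ω => (if t < V ω then (1 : ℝ) else 0) • X ω) = {ω | t < V ω}.indicator X := by
      ext1 ω
      by_cases h : t < V ω <;> simp [h]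
    have hcomap : MeasurableSet[MeasurableSpace.comap V inferInstance] {ω | t < V ω} :=
      ⟨Ioi t, measurableSet_Ioi, rfl⟩
    rw [h1, integral_indicator (hset t), ← setIntegral_condExp hm.comap_le hX hcomap,
      integral_congr_ae (ae_restrict_of_ae hV.meanIndep)]
    simp

/-- The easy inequality: since `V = ∫₀¹ 1_{t < V} dt`, the family of indicators has the same value
as `V`. -/
theorem correlationValues_subset_monotoneValues [IsFiniteMeasure P] {N : ℕ}
    {X : Ω → EuclideanSpace ℝ (Fin N)} (hX : Integrable X P) (Y : Ω → ℝ) :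
    correlationValues P X Y ⊆ monotoneValues P X Y := by
  rintro r ⟨V, hV, rfl⟩
  refine ⟨_, hV.isMonotoneAdmissible hX, integral_congr_ae ?_⟩
  filter_upwards [hV.uniform.ae_mem_Icc] with ω hω
  exact (integral_indicator_lt_eq hω).symm

theorem correlationValues_nonempty [IsProbabilityMeasure P] (hP : IsNonatomic P) {N : ℕ}
    {X : Ω → EuclideanSpace ℝ (Fin N)} (hX : Integrable X P) (hX0 : ∫ ω, X ω ∂P = 0)
    (Y : Ω → ℝ) : (correlationValues P X Y).Nonempty := by
  obtain ⟨U, hU, hUI, hU0⟩ := hP.exists_bounded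
  have h : IsBalancedLabel P (fun i ω => X ω i) 1 fun _ => 0 := by
    refine ⟨measurable_const, by simp, fun k hk => ?_, fun k hk i => ?_⟩
    · obtain rfl : k = 0 := by omega
      simp
    · obtain rfl : k = 0 := by omega
      simpa [hX0] using integral_coord hX i
  obtain ⟨V, hV, hVX, -⟩ := h.exists_uniform hU hUI hU0 (integrable_coord hX) one_pos
  exact ⟨_, V, .of_setIntegral hX hV hVX, rfl⟩

theorem correlationValues_le {N : ℕ} {X : Ω → EuclideanSpace ℝ (Fin N)} {Y : Ω → ℝ}
    (hY : Integrable Y P) {r : ℝ} (hr : r ∈ correlationValues P X Y) : r ≤ ∫ ω, |Y ω| ∂P := by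
  obtain ⟨V, hV, rfl⟩ := hr
  refine (le_abs_self _).trans ?_
  refine norm_integral_le_of_norm_le (f := fun ω => V ω * Y ω) hY.abs ?_
  filter_upwards [hV.uniform.ae_mem_Icc] with ω hω
  rw [norm_mul, Real.norm_of_nonneg hω.1]
  exact mul_le_of_le_one_left (norm_nonneg _) hω.2

/-- Joint measurability of `(t, ω) ↦ V t ω` is not assumed, so the measurability of the integral
over `t` is read off from the Riemann sums. -/
theorem IsMonotoneAdmissible.aestronglyMeasurable_integral {N : ℕ}
    {X : Ω → EuclideanSpace ℝ (Fin N)} {V : ℝ → Ω → ℝ} (hV : IsMonotoneAdmissible P X V) :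
    AEStronglyMeasurable (fun ω => ∫ t in (0 : ℝ)..1, V t ω) P := by
  refine aestronglyMeasurable_of_tendsto_ae Filter.atTop
    (f := fun (M : ℕ) ω => (1 / (M + 1 : ℝ)) * ∑ k ∈ Finset.range M, V ((k + 1) / (M + 1)) ω)
    (fun M => ?_) ?_
  · refine (measurable_const.mul (Finset.measurable_sum _ fun k hk => ?_)).aestronglyMeasurable
    have hk : (k : ℝ) + 1 ≤ M := by exact_mod_cast Finset.mem_range.1 hk
    exact hV.measurable _ ⟨by positivity, by rw [div_le_one (by positivity)]; linarith⟩
  · filter_upwards [hV.mem_Icc, hV.antitone] with ω h1 h2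
    rw [tendsto_iff_dist_tendsto_zero]
    refine squeeze_zero (fun _ => dist_nonneg) (fun M => ?_) tendsto_one_div_add_atTop_nhds_zero_nat
    rw [dist_comm]
    exact abs_integral_sub_riemannSum_le h2 h1 M

end Problems

/-! ### Approximating a monotone family by a uniform variable -/

section Approximation
variable {Ω : Type*} [MeasurableSpace Ω] {P : Measure Ω}

/-- The cell `{N = k}` is the difference of the consecutive tail events `{k ≤ N}` and
`{k + 1 ≤ N}`. -/
theorem isBalancedLabel_of_tails [IsProbabilityMeasure P] {ι : Type*} {X : ι → Ω → ℝ}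
    (hX : ∀ i, Integrable (X i) P) (hX0 : ∀ i, ∫ ω, X i ω ∂P = 0) {M : ℕ} {N : Ω → ℕ}
    (hN : Measurable N) (hNM : ∀ ω, N ω ≤ M)
    (hN1 : ∀ k < M, P.real {ω | k < N ω} = 1 - (k + 1) / (M + 1))
    (hNX : ∀ k < M, ∀ i, ∫ ω in {ω | k < N ω}, X i ω ∂P = 0) :
    IsBalancedLabel P X (M + 1) N := by
  have hm : ∀ k, MeasurableSet {ω | k ≤ N ω} := fun k => hN measurableSet_Ici
  have hM : (M + 1 : ℝ) ≠ 0 := by positivity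
  have tail : ∀ k ≤ M + 1, P.real {ω | k ≤ N ω} = 1 - k / (M + 1) ∧
      ∀ i, ∫ ω in {ω | k ≤ N ω}, X i ω ∂P = 0 := by
    rintro (_ | k) hk
    · simp [hX0]
    · rcases (Nat.succ_le_succ_iff.1 hk).lt_or_eq with h | rfl
      · exact ⟨by simpa using hN1 k h, hNX k h⟩
      · have : {ω | k + 1 ≤ N ω} = ∅ := by
          ext ω; simpa using Nat.lt_succ_of_le (hNM ω)
        rw [this]
        simp [hM]
  have hdiff : ∀ k, {ω | N ω = k} = {ω | k ≤ N ω} \ {ω | k + 1 ≤ N ω} := fun k => by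
    ext ω; simp only [mem_ofPred_eq, mem_sdiff]; omega
  have hsub : ∀ k, {ω | k + 1 ≤ N ω} ⊆ {ω | k ≤ N ω} := fun k ω h => Nat.le_of_succ_le h
  refine ⟨hN, fun ω => Nat.lt_succ_of_le (hNM ω), fun k hk => ?_, fun k hk i => ?_⟩
  · rw [hdiff, measureReal_sdiff (hsub k) (hm _), (tail k hk.le).1, (tail (k + 1) hk).1]
    push_cast
    field_simp
    ring
  · rw [hdiff, setIntegral_sdiff (hm _) (hX i).integrableOn (hsub k), (tail k hk.le).2 i,
      (tail (k + 1) hk).2 i, sub_zero]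

/-- Summation by parts: `N = ∑ₖ 1_{k < N}`. -/
theorem integral_nat_mul_eq_sum {N : Ω → ℕ} (hN : Measurable N) {M : ℕ} (hNM : ∀ ω, N ω ≤ M)
    {Y : Ω → ℝ} (hY : Integrable Y P) :
    ∫ ω, (N ω : ℝ) * Y ω ∂P = ∑ k ∈ Finset.range M, ∫ ω in {ω | k < N ω}, Y ω ∂P := by
  have hm : ∀ k, MeasurableSet {ω | k < N ω} := fun k => hN measurableSet_Ioi
  simp_rw [← integral_indicator (hm _)]
  rw [← integral_finsetSum _ fun k _ => hY.indicator (hm k)]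
  refine integral_congr_ae (.of_forall fun ω => ?_)
  have hind : ∀ k, {ω | k < N ω}.indicator Y ω = if k < N ω then Y ω else 0 := fun k => by
    by_cases h : k < N ω <;> simp [h]
  have hfilter : {k ∈ Finset.range M | k < N ω} = Finset.range (N ω) := by
    ext k
    have := hNM ω
    simp only [Finset.mem_filter, Finset.mem_range]
    omega
  simp only [hind]
  rw [← Finset.sum_filter, hfilter, Finset.sum_const, Finset.card_range, nsmul_eq_mul]

/-- A version of `V` sampled at the points `τ k`, modified on a null event so that the range and
monotonicity constraints hold everywhere. -/
theorem IsMonotoneAdmissible.exists_antitone_sequence {N : ℕ} {X : Ω → EuclideanSpace ℝ (Fin N)}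
    {V : ℝ → Ω → ℝ} (hV : IsMonotoneAdmissible P X V) {τ : ℕ → ℝ} (hτ : Monotone τ)
    (hτI : ∀ k, τ k ∈ Icc (0 : ℝ) 1) :
    ∃ W : ℕ → Ω → ℝ, (∀ k, Measurable (W k)) ∧ (∀ k ω, W k ω ∈ Icc (0 : ℝ) 1) ∧
      (∀ ω, Antitone fun k => W k ω) ∧ ∀ᵐ ω ∂P, ∀ k, W k ω = V (τ k) ω := by
  obtain ⟨G, hG, hGm, hGP⟩ := (hV.mem_Icc.and hV.antitone).exists_measurable_mem
  refine ⟨fun k => G.indicator (V (τ k)), fun k => (hV.measurable _ (hτI k)).indicator hGm,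
    fun k ω => ?_, fun ω k l hkl => ?_, ?_⟩
  · by_cases h : ω ∈ G
    · simpa [h] using (hGP ω h).1 _ (hτI k)
    · simp [h]
  · by_cases h : ω ∈ G
    · simpa [h] using (hGP ω h).2 (hτI k) (hτI l) (hτ hkl)
    · simp [h]
  · filter_upwards [hG] with ω h k
    simp [h]

/-- The main estimate: every admissible family of the monotone problem is matched, up to an error
`2 E|Y| / (M + 1)`, by an admissible variable of the correlation problem. One half of the error is
that of the Riemann sum with mesh `1 / (M + 1)`, the other half is the width of the cells. -/
theorem IsMonotoneAdmissible.exists_isMeanIndepAdmissible [IsProbabilityMeasure P]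
    (hP : IsNonatomic P) {d : ℕ} {X : Ω → EuclideanSpace ℝ (Fin d)} {Y : Ω → ℝ}
    (hX : Integrable X P) (hY : Integrable Y P) (hX0 : ∫ ω, X ω ∂P = 0)
    {V : ℝ → Ω → ℝ} (hV : IsMonotoneAdmissible P X V) (M : ℕ) :
    ∃ V' : Ω → ℝ, IsMeanIndepAdmissible P X V' ∧
      ∫ ω, (∫ t in (0 : ℝ)..1, V t ω * Y ω) ∂P
        ≤ ∫ ω, V' ω * Y ω ∂P + 2 * (1 / (M + 1)) * ∫ ω, |Y ω| ∂P := by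
  obtain ⟨U, hU, hUI, hU0⟩ := hP.exists_bounded
  have hM : (0 : ℝ) < M + 1 := by positivity
  let τ : ℕ → ℝ := fun k => min (((k : ℝ) + 1) / (M + 1)) 1
  have hτ : Monotone τ := fun k l hkl => by
    simp only [τ]
    gcongr
  have hτI : ∀ k, τ k ∈ Icc (0 : ℝ) 1 := fun k =>
    ⟨le_min (by positivity) zero_le_one, min_le_right _ _⟩
  have hτk : ∀ k < M, τ k = (k + 1) / (M + 1) := fun k hk => by
    have hk' : (k : ℝ) + 1 ≤ M := by exact_mod_cast hk
    exact min_eq_left (by rw [div_le_one hM]; linarith)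
  obtain ⟨W, hWm, hWI, hWa, hWV⟩ := hV.exists_antitone_sequence hτ hτI
  have hWint : ∀ k {h : Ω → ℝ}, Integrable h P → Integrable (fun ω => W k ω * h ω) P :=
    fun k _ hh => integrable_mul_of_abs_le_one (hWm k).aestronglyMeasurable
      (.of_forall fun ω => abs_le.2 ⟨by linarith [(hWI k ω).1], (hWI k ω).2⟩) hh
  -- the integrals to be preserved are those of `1`, `Y` and the coordinates of `X`
  let Z : Option (Option (Fin d)) → Ω → ℝ := fun j =>
    j.elim (fun _ => 1) fun j => j.elim Y fun i ω => X ω i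
  have hZ : ∀ j, Integrable (Z j) P := by
    rintro (_ | _ | i)
    · exact integrable_const 1
    · exact hY
    · exact integrable_coord hX i
  obtain ⟨N, hN, hNM, -, hNZ⟩ :=
    exists_nat_valued_setIntegral_eq hU hUI hU0 hZ M W hWm hWI hWa
  have hbal : IsBalancedLabel P (fun i ω => X ω i) (M + 1) N := by
    refine isBalancedLabel_of_tails (integrable_coord hX) (fun i => ?_) hN hNM (fun k hk => ?_)
      fun k hk i => ?_
    · rw [integral_coord hX, hX0]; rfl
    · have h := hNZ k hk none
      simp only [Z, Option.elim, setIntegral_const, smul_eq_mul, mul_one] at h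
      rw [h, ← hτk k hk, ← hV.mean _ (hτI k)]
      refine integral_congr_ae ?_
      filter_upwards [hWV] with ω hω using hω k
    · have h := hNZ k hk (some (some i))
      simp only [Z, Option.elim] at h
      rw [h]
      have hWX : Integrable (fun ω => W k ω • X ω) P :=
        hX.bdd_smul 1 (hWm k).aestronglyMeasurable (.of_forall fun ω =>
          abs_le.2 ⟨by linarith [(hWI k ω).1], (hWI k ω).2⟩)
      have h0 : ∫ ω, W k ω • X ω ∂P = 0 := by
        rw [← hV.orthogonal _ (hτI k)]
        refine integral_congr_ae ?_
        filter_upwards [hWV] with ω hω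
        rw [hω k]
      have := integral_coord hWX i
      rw [h0] at this
      simpa using this
  obtain ⟨V', hV', hV'X, hV'N⟩ :=
    hbal.exists_uniform hU hUI hU0 (integrable_coord hX) (Nat.succ_pos M)
  push_cast at hV'N
  refine ⟨V', .of_setIntegral hX hV' hV'X, ?_⟩
  have hNY : Integrable (fun ω => (N ω : ℝ) * Y ω) P :=
    hY.bdd_mul (c := M) ((measurable_of_countable fun k : ℕ => (k : ℝ)).comp
      hN).aestronglyMeasurable (.of_forall fun ω => by simpa using hNM ω)
  have hV'Y : Integrable (fun ω => V' ω * Y ω) P :=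
    integrable_mul_of_abs_le_one hV'.measurable.aestronglyMeasurable
      (by filter_upwards [hV'.ae_mem_Icc] with ω hω
          exact abs_le.2 ⟨by linarith [hω.1], hω.2⟩) hY
  have hNY' : ∀ k < M, ∫ ω in {ω | k < N ω}, Y ω ∂P = ∫ ω, W k ω * Y ω ∂P := fun k hk =>
    hNZ k hk (some none)
  -- the value of the step function `N / (M + 1)` is the value of the Riemann sum of `V`
  have hsum : (1 / (M + 1 : ℝ)) * ∫ ω, (N ω : ℝ) * Y ω ∂P
      = ∫ ω, (1 / (M + 1 : ℝ)) * (∑ k ∈ Finset.range M, V ((k + 1) / (M + 1)) ω) * Y ω ∂P := by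
    rw [integral_nat_mul_eq_sum hN hNM hY,
      Finset.sum_congr rfl fun k hk => hNY' k (Finset.mem_range.1 hk),
      ← integral_finsetSum _ fun k _ => hWint k hY, ← integral_const_mul]
    refine integral_congr_ae ?_
    filter_upwards [hWV] with ω hω
    rw [mul_assoc, Finset.sum_mul]
    congr 1
    refine Finset.sum_congr rfl fun k hk => ?_
    rw [hω, hτk k (Finset.mem_range.1 hk)]
  have hRint : Integrable (fun ω => (1 / (M + 1 : ℝ)) *
      (∑ k ∈ Finset.range M, V ((k + 1) / (M + 1)) ω) * Y ω) P := by
    have h := (integrable_finsetSum (Finset.range M) fun k _ => hWint k hY).const_mul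
      (1 / (M + 1 : ℝ))
    refine h.congr ?_
    filter_upwards [hWV] with ω hω
    rw [mul_assoc, Finset.sum_mul]
    congr 1
    refine Finset.sum_congr rfl fun k hk => ?_
    rw [hω, hτk k (Finset.mem_range.1 hk)]
  have hYM : Integrable (fun ω => 1 / (M + 1 : ℝ) * |Y ω|) P := hY.abs.const_mul _
  have hIint : Integrable (fun ω => ∫ t in (0 : ℝ)..1, V t ω * Y ω) P := by
    simp_rw [intervalIntegral.integral_mul_const]
    refine (hRint.abs.add hYM).mono'
      (hV.aestronglyMeasurable_integral.mul hY.aestronglyMeasurable) ?_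
    filter_upwards [hV.mem_Icc, hV.antitone] with ω h1 h2
    have h := abs_integral_sub_riemannSum_le h2 h1 M
    have h3 := mul_le_mul_of_nonneg_right h (abs_nonneg (Y ω))
    rw [← abs_mul, sub_mul] at h3
    have h4 := abs_sub_abs_le_abs_sub ((∫ t in (0 : ℝ)..1, V t ω) * Y ω)
      ((1 / (M + 1 : ℝ)) * (∑ k ∈ Finset.range M, V ((k + 1) / (M + 1)) ω) * Y ω)
    simp only [Pi.add_apply, Real.norm_eq_abs]
    linarith
  have step1 : ∫ ω, (∫ t in (0 : ℝ)..1, V t ω * Y ω) ∂P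
      ≤ (1 / (M + 1 : ℝ)) * ∫ ω, (N ω : ℝ) * Y ω ∂P + 1 / (M + 1) * ∫ ω, |Y ω| ∂P := by
    rw [hsum, ← integral_const_mul (1 / (M + 1 : ℝ)) fun ω => |Y ω|, ← integral_add hRint hYM]
    refine integral_mono_ae hIint (hRint.add hYM) ?_
    filter_upwards [hV.mem_Icc, hV.antitone] with ω h1 h2
    have h := abs_integral_sub_riemannSum_le h2 h1 M
    have h3 := mul_le_mul_of_nonneg_right h (abs_nonneg (Y ω))
    rw [← abs_mul, sub_mul] at h3
    simp only [intervalIntegral.integral_mul_const]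
    linarith [le_abs_self ((∫ t in (0 : ℝ)..1, V t ω) * Y ω -
      (1 / (M + 1 : ℝ)) * (∑ k ∈ Finset.range M, V ((k + 1) / (M + 1)) ω) * Y ω)]
  have step2 : (1 / (M + 1 : ℝ)) * ∫ ω, (N ω : ℝ) * Y ω ∂P
      ≤ ∫ ω, V' ω * Y ω ∂P + 1 / (M + 1) * ∫ ω, |Y ω| ∂P := by
    rw [← integral_const_mul, ← integral_const_mul, ← integral_add hV'Y hYM]
    refine integral_mono (hNY.const_mul _) (hV'Y.add hYM) fun ω => ?_
    obtain ⟨h1, h2⟩ := hV'N ω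
    have h3 : |V' ω - N ω / (M + 1)| ≤ 1 / (M + 1) := abs_le.2 ⟨by linarith, h2⟩
    have h4 := mul_le_mul_of_nonneg_right h3 (abs_nonneg (Y ω))
    rw [← abs_mul, sub_mul] at h4
    have h5 := neg_abs_le (V' ω * Y ω - N ω / (M + 1) * Y ω)
    have h6 : 1 / (M + 1 : ℝ) * ((N ω : ℝ) * Y ω) = N ω / (M + 1) * Y ω := by ring
    linarith
  linarith

end Approximation
end KoenkerBassett

/-- Both suprema are finite and they are equal: some real number is the least upper bound of the
values of each problem. (A set of reals with a least upper bound is nonempty and bounded above, so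
no junk value of `sSup` is involved.) -/
theorem theorem4p1 {Ω : Type*} [MeasurableSpace Ω] (P : MeasureTheory.Measure Ω)
    [MeasureTheory.IsProbabilityMeasure P] (hP : KoenkerBassett.IsNonatomic P)
    {N : ℕ} (X : Ω → EuclideanSpace ℝ (Fin N)) (Y : Ω → ℝ)
    (hX : MeasureTheory.Integrable X P) (hY : MeasureTheory.Integrable Y P)
    (hX0 : ∫ ω, X ω ∂P = 0) :
    ∃ s : ℝ, IsLUB (KoenkerBassett.correlationValues P X Y) s ∧
      IsLUB (KoenkerBassett.monotoneValues P X Y) s := by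
  have hlub := isLUB_csSup (KoenkerBassett.correlationValues_nonempty hP hX hX0 Y)
    ⟨_, fun _ hr => KoenkerBassett.correlationValues_le hY hr⟩
  refine ⟨_, hlub, ?_, fun b hb =>
    hlub.2 fun r hr => hb (KoenkerBassett.correlationValues_subset_monotoneValues hX Y hr)⟩
  rintro r ⟨V, hV, rfl⟩
  have hlim : Filter.Tendsto (fun M : ℕ => sSup (KoenkerBassett.correlationValues P X Y) +
      2 * (1 / ((M : ℝ) + 1)) * ∫ ω, |Y ω| ∂P) Filter.atTop
      (nhds (sSup (KoenkerBassett.correlationValues P X Y) + 2 * 0 * ∫ ω, |Y ω| ∂P)) :=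
    ((tendsto_one_div_add_atTop_nhds_zero_nat.const_mul 2).mul_const _).const_add _
  rw [mul_zero, zero_mul, add_zero] at hlim
  refine ge_of_tendsto' hlim fun M => ?_
  obtain ⟨V', hV', hle⟩ := hV.exists_isMeanIndepAdmissible hP hX hY hX0 M
  linarith [hlub.1 ⟨V', hV', rfl⟩]
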